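/- Let $F$ be a finite forest of order $n$ with no isolated vertex. A set $D\subseteq V(F)$ is a total dominating set of $F$ if every vertex of $F$ (including those in $D$) has a neighbor in $D$. Let $\gamma_t$ be the total domination number of $F$, that is, the minimum cardinality of a total dominating set of $F$, and let $\sharp\gamma_t(F)$ be the number of minimum total dominating sets of $F$, that is, of total dominating sets of cardinality $\gamma_t$. Then $$\sharp\gamma_t(F)\le (1+\sqrt 2)^{\,n-\gamma_t},$$ with equality if and only if every connected component of $F$ is (isomorphic to) the complete graph $K_2$. -/

import Mathlib

namespace SimpleGraph

variable {V : Type*}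

/-- `D` is a total dominating set of `G`: every vertex of `G` has a neighbor in `D`. -/
def IsTotalDominatingSet (G : SimpleGraph V) (D : Finset V) : Prop :=
  ∀ v : V, ∃ w ∈ D, G.Adj v w

/-- The total domination number `γ_t(G)`: the minimum cardinality of a total dominating set of `G`.
(If `G` is finite and has no isolated vertex, then the set of all vertices is totally dominating, so
that the infimum is an attained minimum.) -/
noncomputable def totalDominationNumber (G : SimpleGraph V) : ℕ :=
  sInf {k : ℕ | ∃ D : Finset V, G.IsTotalDominatingSet D ∧ D.card = k}

/-- `D` is a minimum total dominating set (a `γ_t`-set) of `G`: a total dominating set of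
cardinality `γ_t(G)`. -/
def IsMinimumTotalDominatingSet (G : SimpleGraph V) (D : Finset V) : Prop :=
  G.IsTotalDominatingSet D ∧ D.card = G.totalDominationNumber

/-- `♯γ_t(G)`: the number of minimum total dominating sets of a finite graph `G`. -/
noncomputable def numMinimumTotalDominatingSets (G : SimpleGraph V) : ℕ :=
  Set.ncard {D : Finset V | G.IsMinimumTotalDominatingSet D}

end SimpleGraph

namespace SimpleGraph

variable {V : Type*}

/-! In a forest, total domination is dual to open packing: some set P of γ_t vertices has pairwise
disjoint open neighborhoods (`IsAcyclic.exists_isOpenPacking_card_eq`). A total dominating set meets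
each of them, so a minimum one consists of exactly one neighbor per vertex of P. The count is thus
at most ∏ deg v ≤ 2 ^ ∑ (deg v - 1) over P, and disjointness bounds the exponent by n - γ_t.

Since 2 < 1 + √2, equality forces n = γ_t. Then P is all of V and every degree is 1, i.e. every
component is K₂. -/

/-- In a forest, at most one neighbor of `v` is at distance at most `dist r v` from `r`. -/
theorem IsAcyclic.eq_of_adj_of_dist_le {G : SimpleGraph V} (hG : G.IsAcyclic) {r v x y : V}
    (hr : G.Reachable r v) (hx : G.Adj x v) (hy : G.Adj y v)
    (hdx : G.dist r x ≤ G.dist r v) (hdy : G.dist r y ≤ G.dist r v) : x = y := by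
  classical
  have key : ∀ z, G.Adj z v → G.dist r z ≤ G.dist r v →
      ∃ p : G.Walk r v, p.IsPath ∧ p.penultimate = z := by
    intro z hz hd
    obtain ⟨p, hp, hl⟩ := (hr.trans hz.symm.reachable).exists_path_of_dist
    refine ⟨p.concat hz, ?_, by simp⟩
    refine hp.concat ?_ hz
    -- If a shortest path from r to z passed through v, then v would be strictly closer to r than z.
    intro hv
    have h1 : G.dist r v ≤ (p.takeUntil v hv).length := dist_le _
    have h2 : (p.takeUntil v hv).length < p.length := p.length_takeUntil_lt_length hv hz.ne'
    omega
  obtain ⟨p, hp, rfl⟩ := key x hx hdx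
  obtain ⟨q, hq, rfl⟩ := key y hy hdy
  have : (⟨p, hp⟩ : G.Path r v) = ⟨q, hq⟩ := (hG.subsingleton_path r v).elim _ _
  rw [Subtype.mk.inj this]

/-- The distance of `v` from a fixed root of its connected component. -/
noncomputable def rootDist (G : SimpleGraph V) (v : V) : ℕ :=
  G.dist (G.connectedComponentMk v).out v

theorem IsAcyclic.eq_of_adj_of_rootDist_le {G : SimpleGraph V} (hG : G.IsAcyclic) {v x y : V}
    (hx : G.Adj v x) (hy : G.Adj v y)
    (hdx : G.rootDist x ≤ G.rootDist v) (hdy : G.rootDist y ≤ G.rootDist v) : x = y := by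
  have hcx : G.connectedComponentMk x = G.connectedComponentMk v :=
    ConnectedComponent.sound hx.symm.reachable
  have hcy : G.connectedComponentMk y = G.connectedComponentMk v :=
    ConnectedComponent.sound hy.symm.reachable
  unfold rootDist at hdx hdy
  rw [hcx] at hdx
  rw [hcy] at hdy
  refine hG.eq_of_adj_of_dist_le ?_ hx.symm hy.symm hdx hdy
  exact ConnectedComponent.exact (Quot.out_eq _)

/-- Take v deepest in S and u its parent (any neighbor if v is a root). A common neighbor x of v and
w is either u or a child of v; in the latter case w is no deeper than v, so both are the parent of x
and w = v. -/
theorem IsAcyclic.exists_adj_forall_common_neighbor {G : SimpleGraph V} (hG : G.IsAcyclic)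
    (hiso : ∀ v, ∃ w, G.Adj v w) {S : Finset V} (hS : S.Nonempty) :
    ∃ v ∈ S, ∃ u, G.Adj v u ∧ ∀ w ∈ S, ∀ x, G.Adj v x → G.Adj w x → G.Adj w u := by
  obtain ⟨v, hv, hmax⟩ := S.exists_max_image G.rootDist hS
  obtain ⟨u, hu, hlow⟩ : ∃ u, G.Adj v u ∧
      ∀ x, G.Adj v x → G.rootDist x ≤ G.rootDist v → x = u := by
    by_cases h : ∃ u, G.Adj v u ∧ G.rootDist u ≤ G.rootDist v
    · obtain ⟨u, hu, hd⟩ := h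
      exact ⟨u, hu, fun x hx hdx => hG.eq_of_adj_of_rootDist_le hx hu hdx hd⟩
    · obtain ⟨u, hu⟩ := hiso v
      exact ⟨u, hu, fun x hx hdx => (h ⟨x, hx, hdx⟩).elim⟩
  refine ⟨v, hv, u, hu, fun w hw x hvx hwx => ?_⟩
  by_cases hxv : G.rootDist x ≤ G.rootDist v
  · rwa [← hlow x hvx hxv]
  · have := hmax w hw
    rwa [hG.eq_of_adj_of_rootDist_le hwx.symm hvx.symm (by omega) (by omega)]

/-- An open packing: no two distinct vertices of `P` have a common neighbor. -/
def IsOpenPacking (G : SimpleGraph V) (P : Finset V) : Prop :=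
  ∀ v ∈ P, ∀ w ∈ P, ∀ x, G.Adj v x → G.Adj w x → v = w

/-- Greedy duality: put v in P and u in D, then discard all of S adjacent to u. By the choice of u,
no remaining vertex shares a neighbor with v. -/
theorem IsAcyclic.exists_isOpenPacking_card_ge {G : SimpleGraph V} (hG : G.IsAcyclic)
    (hiso : ∀ v, ∃ w, G.Adj v w) (S : Finset V) :
    ∃ D P : Finset V, (∀ v ∈ S, ∃ w ∈ D, G.Adj v w) ∧ P ⊆ S ∧ G.IsOpenPacking P ∧
      D.card ≤ P.card := by
  classical
  induction S using Finset.strongInduction with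
  | H S ih =>
    obtain rfl | hS := S.eq_empty_or_nonempty
    · exact ⟨∅, ∅, by simp, by simp, by simp [IsOpenPacking], le_rfl⟩
    obtain ⟨v, hv, u, hvu, hcommon⟩ := hG.exists_adj_forall_common_neighbor hiso hS
    obtain ⟨D, P, hD, hPS, hP, hcard⟩ := ih (S.filter fun w => ¬ G.Adj w u)
      (Finset.filter_ssubset.2 ⟨v, hv, by simpa using hvu⟩)
    have hmem : ∀ w ∈ P, w ∈ S ∧ ¬ G.Adj w u := fun w hw => by simpa using hPS hw
    have hvP : v ∉ P := fun h => (hmem v h).2 hvu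
    refine ⟨insert u D, insert v P, ?_, ?_, ?_, ?_⟩
    · intro w hw
      by_cases hwu : G.Adj w u
      · exact ⟨u, by simp, hwu⟩
      · obtain ⟨x, hx, hwx⟩ := hD w (by simp [hw, hwu])
        exact ⟨x, by simp [hx], hwx⟩
    · exact Finset.insert_subset hv fun w hw => (hmem w hw).1
    · intro a ha b hb x hax hbx
      rcases Finset.mem_insert.1 ha with rfl | haP <;> rcases Finset.mem_insert.1 hb with rfl | hbP
      · rfl
      · exact ((hmem b hbP).2 (hcommon b (hmem b hbP).1 x hax hbx)).elim
      · exact ((hmem a haP).2 (hcommon a (hmem a haP).1 x hbx hax)).elim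
      · exact hP a haP b hbP x hax hbx
    · rw [Finset.card_insert_of_notMem hvP]
      exact (Finset.card_insert_le _ _).trans (by omega)

theorem IsTotalDominatingSet.totalDominationNumber_le {G : SimpleGraph V} {D : Finset V}
    (hD : G.IsTotalDominatingSet D) : G.totalDominationNumber ≤ D.card :=
  Nat.sInf_le ⟨D, hD, rfl⟩

theorem IsTotalDominatingSet.exists_isMinimumTotalDominatingSet {G : SimpleGraph V} {D : Finset V}
    (hD : G.IsTotalDominatingSet D) : ∃ D', G.IsMinimumTotalDominatingSet D' :=
  Nat.sInf_mem (s := {k : ℕ | ∃ D : Finset V, G.IsTotalDominatingSet D ∧ D.card = k})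
    ⟨_, D, hD, rfl⟩

theorem IsOpenPacking.card_image [DecidableEq V] {G : SimpleGraph V} {P : Finset V}
    (hP : G.IsOpenPacking P) {f : ∀ v ∈ P, V} (hf : ∀ v hv, G.Adj v (f v hv)) :
    (P.attach.image fun v => f v.1 v.2).card = P.card := by
  rw [Finset.card_image_of_injective, Finset.card_attach]
  intro a b hab
  refine Subtype.ext (hP a a.2 b b.2 (f a a.2) (hf _ _) ?_)
  have hab' : f a a.2 = f b b.2 := hab
  rw [hab']
  exact hf _ _

/-- A total dominating set contains the range of a choice of neighbors for an open packing. -/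
theorem IsOpenPacking.exists_image_subset [DecidableEq V] {G : SimpleGraph V} {P D : Finset V}
    (hP : G.IsOpenPacking P) (hD : G.IsTotalDominatingSet D) :
    ∃ f : ∀ v ∈ P, V, (∀ v hv, G.Adj v (f v hv)) ∧
      (P.attach.image fun v => f v.1 v.2) ⊆ D ∧
      (P.attach.image fun v => f v.1 v.2).card = P.card := by
  choose f hfD hf using hD
  refine ⟨fun v _ => f v, fun v _ => hf v, ?_, hP.card_image fun v _ => hf v⟩
  intro x hx
  obtain ⟨v, -, rfl⟩ := Finset.mem_image.1 hx
  exact hfD _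

theorem IsOpenPacking.card_le {G : SimpleGraph V} {P D : Finset V}
    (hP : G.IsOpenPacking P) (hD : G.IsTotalDominatingSet D) : P.card ≤ D.card := by
  classical
  obtain ⟨f, -, hsub, hcard⟩ := hP.exists_image_subset hD
  exact hcard ▸ Finset.card_le_card hsub

/-- In a forest without isolated vertices, the total domination number equals the open packing
number. -/
theorem IsAcyclic.exists_isOpenPacking_card_eq [Fintype V] {G : SimpleGraph V}
    (hG : G.IsAcyclic) (hiso : ∀ v, ∃ w, G.Adj v w) :
    ∃ P, G.IsOpenPacking P ∧ P.card = G.totalDominationNumber := by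
  obtain ⟨D, P, hD, -, hP, hcard⟩ := hG.exists_isOpenPacking_card_ge hiso Finset.univ
  have hD' : G.IsTotalDominatingSet D := fun v => hD v (Finset.mem_univ v)
  obtain ⟨D₀, hD₀, hc⟩ := hD'.exists_isMinimumTotalDominatingSet
  exact ⟨P, hP, (hc ▸ hP.card_le hD₀).antisymm (hD'.totalDominationNumber_le.trans hcard)⟩

theorem IsOpenPacking.numMinimumTotalDominatingSets_le_prod_degree [Fintype V]
    {G : SimpleGraph V} [DecidableRel G.Adj] {P : Finset V}
    (hP : G.IsOpenPacking P) (hcard : P.card = G.totalDominationNumber) :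
    G.numMinimumTotalDominatingSets ≤ ∏ v ∈ P, G.degree v := by
  classical
  have hsub : {D : Finset V | G.IsMinimumTotalDominatingSet D} ⊆
      (((P.pi fun v => G.neighborFinset v).image
        fun f => P.attach.image fun v => f v.1 v.2 : Finset (Finset V)) : Set (Finset V)) := by
    rintro D ⟨hD, hDc⟩
    obtain ⟨f, hf, hfD, hfc⟩ := hP.exists_image_subset hD
    refine Finset.mem_coe.2 (Finset.mem_image.2 ⟨f, ?_, ?_⟩)
    · exact Finset.mem_pi.2 fun v hv => (G.mem_neighborFinset v _).2 (hf v hv)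
    -- The chosen neighbors already number |P| = γ_t = |D|, so they exhaust D.
    · exact Finset.eq_of_subset_of_card_le hfD (by omega)
  calc G.numMinimumTotalDominatingSets
      ≤ _ := Set.ncard_le_ncard hsub (Finset.finite_toSet _)
    _ ≤ (P.pi fun v => G.neighborFinset v).card := by
        rw [Set.ncard_coe_finset]
        exact Finset.card_image_le
    _ = ∏ v ∈ P, G.degree v := by simp [Finset.card_pi]

theorem IsOpenPacking.sum_degree_le [Fintype V] {G : SimpleGraph V} [DecidableRel G.Adj]
    {P : Finset V} (hP : G.IsOpenPacking P) : ∑ v ∈ P, G.degree v ≤ Fintype.card V := by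
  classical
  have hdisj : (P : Set V).PairwiseDisjoint fun v => G.neighborFinset v := by
    intro v hv w hw hne
    refine Finset.disjoint_left.2 fun x hx hx' => hne (hP v hv w hw x ?_ ?_)
    · exact (G.mem_neighborFinset v x).1 hx
    · exact (G.mem_neighborFinset w x).1 hx'
  have := Finset.card_biUnion hdisj
  simp only [card_neighborFinset_eq_degree] at this
  rw [← this]
  exact Finset.card_le_univ _

theorem IsOpenPacking.prod_degree_le_two_pow [Fintype V] {G : SimpleGraph V} [DecidableRel G.Adj]
    {P : Finset V} (hP : G.IsOpenPacking P) (hiso : ∀ v, ∃ w, G.Adj v w) :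
    ∏ v ∈ P, G.degree v ≤ 2 ^ (Fintype.card V - P.card) := by
  have hpos : ∀ v, 1 ≤ G.degree v := fun v =>
    (G.degree_pos_iff_exists_adj v).2 (hiso v)
  have hsum : ∑ v ∈ P, (G.degree v - 1) + P.card = ∑ v ∈ P, G.degree v := by
    rw [Finset.card_eq_sum_ones, ← Finset.sum_add_distrib]
    exact Finset.sum_congr rfl fun v _ => Nat.sub_add_cancel (hpos v)
  calc ∏ v ∈ P, G.degree v ≤ ∏ v ∈ P, 2 ^ (G.degree v - 1) := by
        -- Factorwise this is d ≤ 2 ^ (d - 1) for d ≥ 1.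
        refine Finset.prod_le_prod' fun v _ => ?_
        have : G.degree v - 1 < 2 ^ (G.degree v - 1) := Nat.lt_two_pow_self
        have := hpos v
        omega
    _ = 2 ^ ∑ v ∈ P, (G.degree v - 1) := Finset.prod_pow_eq_pow_sum _ _ _
    _ ≤ 2 ^ (Fintype.card V - P.card) := by
        refine Nat.pow_le_pow_right two_pos ?_
        have := hP.sum_degree_le
        omega

theorem totalDominationNumber_eq_card_of_existsUnique_adj [Fintype V] {G : SimpleGraph V}
    (h : ∀ v, ∃! w, G.Adj v w) : G.totalDominationNumber = Fintype.card V := by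
  have huniv : G.IsTotalDominatingSet Finset.univ := fun v => by
    obtain ⟨w, hw, -⟩ := h v
    exact ⟨w, Finset.mem_univ w, hw⟩
  obtain ⟨D, hD, hc⟩ := huniv.exists_isMinimumTotalDominatingSet
  have hDu : D = Finset.univ := by
    -- The vertex v is the only neighbor of its neighbor w, so dominating w forces v into D.
    refine Finset.eq_univ_iff_forall.2 fun v => ?_
    obtain ⟨w, hw, -⟩ := h v
    obtain ⟨x, hx, hwx⟩ := hD w
    rwa [(h w).unique hw.symm hwx]
  rw [← hc, hDu, Finset.card_univ]

theorem IsAcyclic.totalDominationNumber_eq_card_iff [Fintype V] {G : SimpleGraph V}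
    (hG : G.IsAcyclic) (hiso : ∀ v, ∃ w, G.Adj v w) :
    G.totalDominationNumber = Fintype.card V ↔ ∀ v, ∃! w, G.Adj v w := by
  classical
  refine ⟨fun h v => ?_, totalDominationNumber_eq_card_of_existsUnique_adj⟩
  obtain ⟨P, hP, hcard⟩ := hG.exists_isOpenPacking_card_eq hiso
  have hPu : P = Finset.univ := P.card_eq_iff_eq_univ.1 (hcard.trans h)
  subst hPu
  have hpos : ∀ v ∈ Finset.univ, 1 ≤ G.degree v := fun v _ =>
    (G.degree_pos_iff_exists_adj v).2 (hiso v)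
  -- Disjoint neighborhoods give degree sum at most n, while each of the n degrees is at least 1.
  have hsum : ∑ v, 1 = ∑ v, G.degree v :=
    (Finset.sum_le_sum hpos).antisymm (hP.sum_degree_le.trans (by simp))
  exact G.degree_eq_one_iff_existsUnique_adj.1
    ((Finset.sum_eq_sum_iff_of_le hpos).1 hsum v (Finset.mem_univ v)).symm

theorem forall_existsUnique_adj_iff {G : SimpleGraph V} :
    (∀ v, ∃! w, G.Adj v w) ↔
      ∀ C : G.ConnectedComponent, Nonempty (C.toSimpleGraph ≃g (⊤ : SimpleGraph (Fin 2))) := by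
  classical
  constructor
  · intro h C
    induction C using ConnectedComponent.ind with | h v => ?_
    obtain ⟨w, hvw, huniq⟩ := h v
    -- A walk from v can only alternate between v and w.
    have hsupp : ∀ x, G.Reachable v x → x = v ∨ x = w := by
      rintro x ⟨p⟩
      induction p using Walk.concatRec with
      | Hnil => exact .inl rfl
      | Hconcat p hadj ih =>
        rcases ih hvw huniq with rfl | rfl
        · exact .inr (huniq _ hadj)
        · exact .inl ((h _).unique hadj hvw.symm)
    let a : (G.connectedComponentMk v).supp := ⟨v, rfl⟩
    let b : (G.connectedComponentMk v).supp := ⟨w, ConnectedComponent.sound hvw.symm.reachable⟩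
    have hab : a ≠ b := fun hab => hvw.ne (congrArg Subtype.val hab)
    have hcases : ∀ x : (G.connectedComponentMk v).supp, x = a ∨ x = b := fun x =>
      (hsupp x.1 (ConnectedComponent.exact x.2).symm).imp Subtype.ext Subtype.ext
    refine ⟨⟨⟨fun x => if x = a then 0 else 1, fun i => if i = 0 then a else b, ?_, ?_⟩, ?_⟩⟩
    · intro x
      rcases hcases x with rfl | rfl
      · simp
      · simp [hab.symm]
    · intro i
      fin_cases i
      · simp
      · simp [hab.symm]
    · intro x y
      have hadj : (G.connectedComponentMk v).toSimpleGraph.Adj a b := hvw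
      rcases hcases x with rfl | rfl <;> rcases hcases y with rfl | rfl
      · simp
      · simpa [hab.symm] using hadj
      · simpa [hab.symm] using hadj.symm
      · simp
  · intro h v
    obtain ⟨e⟩ := h (G.connectedComponentMk v)
    let a : (G.connectedComponentMk v).supp := ⟨v, rfl⟩
    obtain ⟨i, hi, huniq⟩ : ∃ i, e a ≠ i ∧ ∀ j, e a ≠ j → j = i := by
      generalize e a = k
      revert k
      decide
    refine ⟨(e.symm i).1, ?_, fun x hx => ?_⟩
    · have : (G.connectedComponentMk v).toSimpleGraph.Adj a (e.symm i) := by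
        rw [← e.map_adj_iff]
        simpa using hi
      exact this
    · let b : (G.connectedComponentMk v).supp := ⟨x, ConnectedComponent.sound hx.symm.reachable⟩
      have hadj : (G.connectedComponentMk v).toSimpleGraph.Adj a b := hx
      rw [← e.map_adj_iff] at hadj
      rw [← huniq (e b) hadj.ne, e.symm_apply_apply]

theorem IsAcyclic.numMinimumTotalDominatingSets_le_two_pow [Fintype V] {G : SimpleGraph V}
    (hG : G.IsAcyclic) (hiso : ∀ v, ∃ w, G.Adj v w) :
    G.numMinimumTotalDominatingSets ≤ 2 ^ (Fintype.card V - G.totalDominationNumber) := by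
  classical
  obtain ⟨P, hP, hcard⟩ := hG.exists_isOpenPacking_card_eq hiso
  exact hcard ▸ (hP.numMinimumTotalDominatingSets_le_prod_degree hcard).trans
    (hP.prod_degree_le_two_pow hiso)

end SimpleGraph

theorem theorem1p3 {V : Type*} [Fintype V] (F : SimpleGraph V)
    (hforest : F.IsAcyclic) (hiso : ∀ v : V, ¬ F.IsIsolated v) :
    (F.numMinimumTotalDominatingSets : ℝ) ≤
        (1 + Real.sqrt 2) ^ ((Fintype.card V : ℤ) - (F.totalDominationNumber : ℤ)) ∧
      ((F.numMinimumTotalDominatingSets : ℝ) =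
          (1 + Real.sqrt 2) ^ ((Fintype.card V : ℤ) - (F.totalDominationNumber : ℤ)) ↔
        ∀ C : F.ConnectedComponent,
          Nonempty (C.toSimpleGraph ≃g (⊤ : SimpleGraph (Fin 2)))) := by
  have hadj : ∀ v, ∃ w, F.Adj v w := fun v => by
    by_contra! h
    exact hiso v h
  have huniv : F.IsTotalDominatingSet Finset.univ := fun v =>
    (hadj v).imp fun w hw => ⟨Finset.mem_univ w, hw⟩
  have hγ : F.totalDominationNumber ≤ Fintype.card V := huniv.totalDominationNumber_le
  have hcount : (F.numMinimumTotalDominatingSets : ℝ) ≤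
      2 ^ (Fintype.card V - F.totalDominationNumber) := by
    exact_mod_cast hforest.numMinimumTotalDominatingSets_le_two_pow hadj
  have hbase : (2 : ℝ) < 1 + Real.sqrt 2 := by
    have : (1 : ℝ) < Real.sqrt 2 := Real.lt_sqrt_of_sq_lt (by norm_num)
    linarith
  rw [← SimpleGraph.forall_existsUnique_adj_iff,
    ← hforest.totalDominationNumber_eq_card_iff hadj, ← Nat.cast_sub hγ, zpow_natCast]
  refine ⟨hcount.trans (pow_le_pow_left₀ two_pos.le hbase.le _), fun h => ?_, fun h => ?_⟩
  · by_contra hne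
    exact absurd (h ▸ hcount) (not_le.2 (pow_lt_pow_left₀ hbase two_pos.le (by omega)))
  -- With exponent 0 the bound is 1, and at least one minimum set exists.
  · rw [h, Nat.sub_self, pow_zero] at hcount ⊢
    obtain ⟨D, hD⟩ := huniv.exists_isMinimumTotalDominatingSet
    have hpos : 0 < F.numMinimumTotalDominatingSets :=
      (Set.ncard_pos (Set.toFinite _)).2 ⟨D, hD⟩
    exact hcount.antisymm (by exact_mod_cast hpos)
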